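/- Let $K$ be a field of characteristic $0$ and $R=K[x_1,\dots,x_n]$. A matrix $g=(g_{ij})\in \mathrm{GL}_n(K)$ acts on $R$ as the $K$-algebra automorphism with $g(x_i)=\sum_j g_{ji}x_j$. All term orders $\tau$ are assumed to satisfy $x_1>_\tau x_2>_\tau\dots>_\tau x_n$. For a subspace $U\subseteq R$ let $\mathrm{in}_\tau(U)$ be the span of the leading terms of the elements of $U$, and for an ideal $I$ let $\mathrm{in}_\tau(I)$ be the ideal generated by the leading terms of its elements. $\mathrm{Gin}_\tau(U)$ (respectively $\mathrm{Gin}_\tau(I)$) denotes the value that $\mathrm{in}_\tau(g(U))$ (respectively $\mathrm{in}_\tau(g(I))$) takes for generic $g$, i.e. for all $g$ in some nonempty Zariski open subset of $\mathrm{GL}_n(K)$, if there is such a value; it is then unique. The Borel order on the set $M_d$ of monomials of degree $d$ is given by $x^a\ge_{\mathrm{Borel}} x^b$ iff $a_1+\dots+a_k\ge b_1+\dots+b_k$ for all $k=1,\dots,n$. Let $A$ be a subspace of $R$ that is spanned by monomials of degree $d$ and is Borel-fixed, i.e. invariant under all invertible upper triangular matrices. A lower neighbor of $A$ is a monomial $b\in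 M_d$ such that $b\notin A$ and $a\in A$ for every $a\in M_d$ with $a>_{\mathrm{Borel}}b$. If $V$ is a subspace of the span of the lower neighbors of $A$, then $A+V$ is called an almost Borel-fixed space. A homogeneous ideal $I$ is called almost Borel-fixed if for each $d\in\mathbf N$ its degree $d$ component $I_d$ is an almost Borel-fixed space. **Proposition 5.4.** (1) Let $d\in\mathbf N$, let $A$ be a Borel-fixed space of monomials of degree $d$, and let $V$ be a subspace of the span of the lower neighbors of $A$. Then for every term order $\tau$, $\mathrm{Gin}_\tau(A+V)$ exists and $$\mathrm{Gin}_\tau(A+V)=A+\mathrm{in}_\tau(V).$$ (2) Consequently, let $I$ be an almost Borel-fixed ideal, and for each $d$ write $I_d=A_d+V_d$, where $A_d$ is a Borel-fixed space of monomials of degree $d$ and $V_d$ is a subspace of the span of the lower neighbors of $A_d$. Then for every term order $\tau$, $\mathrm{Gin}_\tau(I)$ exists, is a homogeneous ideal, and $$\mathrm{Gin}_\tau(I)_d=A_d+\mathrm{in}_\tau(V_d)\qquad\text{for all } d\in\mathbf N .$$ -/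

import Mathlib

open MvPolynomial
open scoped MonomialOrder

namespace GenericInitial

noncomputable section

/-! ### The action of the general linear group and generic matrices -/

/-- The `K`-algebra endomorphism of `K[x_1,…,x_n]` with `g(x_i) = ∑_j g_{ji} x_j`. -/
def changeCoords {n : ℕ} {K : Type*} [Field K] (g : GL (Fin n) K) :
    MvPolynomial (Fin n) K →ₐ[K] MvPolynomial (Fin n) K :=
  aeval fun i => ∑ j, C (g j i) * X j

/-- `Q g` holds for a generic `g`: it holds for all invertible `g` outside the zero set of some
nonzero polynomial in the entries of `g`.  Over an infinite field this says that `Q` holds on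
a nonempty Zariski open subset of `GL_n(K)`. -/
def HoldsGenerically {n : ℕ} {K : Type*} [Field K] (Q : GL (Fin n) K → Prop) : Prop :=
  ∃ P : MvPolynomial (Fin n × Fin n) K, P ≠ 0 ∧
    ∀ g : GL (Fin n) K, eval (fun ij => g ij.1 ij.2) P ≠ 0 → Q g

/-! ### Initial spaces and generic initial spaces -/

/-- The term orders under consideration are those with `x_1 > x_2 > … > x_n`. -/
def IsStandardOrder {n : ℕ} (τ : MonomialOrder (Fin n)) : Prop :=
  ∀ i j : Fin n, i < j → Finsupp.single j 1 ≺[τ] Finsupp.single i 1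

/-- The initial space of a subspace `U`: the span of the leading terms of its elements. -/
def initialSpace {n : ℕ} {K : Type*} [Field K] (τ : MonomialOrder (Fin n))
    (U : Submodule K (MvPolynomial (Fin n) K)) : Submodule K (MvPolynomial (Fin n) K) :=
  Submodule.span K (τ.leadingTerm '' (U : Set (MvPolynomial (Fin n) K)))

/-- The initial ideal of an ideal `I`: the ideal generated by the leading terms of its elements. -/
def initialIdeal {n : ℕ} {K : Type*} [Field K] (τ : MonomialOrder (Fin n))
    (I : Ideal (MvPolynomial (Fin n) K)) : Ideal (MvPolynomial (Fin n) K) :=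
  Ideal.span (τ.leadingTerm '' (I : Set (MvPolynomial (Fin n) K)))

/-- `G` is the generic initial space of `U`: `in_τ(g(U)) = G` for generic `g`. -/
def IsGinSpace {n : ℕ} {K : Type*} [Field K] (τ : MonomialOrder (Fin n))
    (U G : Submodule K (MvPolynomial (Fin n) K)) : Prop :=
  HoldsGenerically fun g : GL (Fin n) K =>
    initialSpace τ (U.map (changeCoords g).toLinearMap) = G

/-- `J` is the generic initial ideal of `I`: `in_τ(g(I)) = J` for generic `g`
(`changeCoords g` is surjective, so that `Ideal.map` is the image). -/
def IsGinIdeal {n : ℕ} {K : Type*} [Field K] (τ : MonomialOrder (Fin n))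
    (I J : Ideal (MvPolynomial (Fin n) K)) : Prop :=
  HoldsGenerically fun g : GL (Fin n) K => initialIdeal τ (I.map (changeCoords g)) = J

/-! ### Borel-fixed spaces and lower neighbors -/

/-- `A` is spanned by monomials of degree `d`. -/
def IsMonomialSpace {n : ℕ} {K : Type*} [Field K] (d : ℕ)
    (A : Submodule K (MvPolynomial (Fin n) K)) : Prop :=
  ∃ S : Set (Fin n →₀ ℕ), (∀ a ∈ S, a.degree = d) ∧
    A = Submodule.span K ((fun a => monomial a (1 : K)) '' S)

/-- `A` is invariant under all invertible upper triangular matrices. -/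
def IsBorelFixed {n : ℕ} {K : Type*} [Field K]
    (A : Submodule K (MvPolynomial (Fin n) K)) : Prop :=
  ∀ g : GL (Fin n) K, (g : Matrix (Fin n) (Fin n) K).BlockTriangular id →
    A.map (changeCoords g).toLinearMap ≤ A

/-- The Borel order `x^a ≥ x^b`: all partial sums satisfy `a_1 + … + a_k ≥ b_1 + … + b_k`. -/
def BorelGE {n : ℕ} (a b : Fin n →₀ ℕ) : Prop :=
  ∀ k : Fin n, ∑ i ∈ Finset.Iic k, b i ≤ ∑ i ∈ Finset.Iic k, a i

/-- (The exponents of) the lower neighbors of `A`: the monomials of degree `d` that are not in `A`,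
while every monomial of degree `d` that is strictly larger in the Borel order is in `A`. -/
def lowerNeighbors {n : ℕ} {K : Type*} [Field K] (d : ℕ)
    (A : Submodule K (MvPolynomial (Fin n) K)) : Set (Fin n →₀ ℕ) :=
  {b | b.degree = d ∧ monomial b (1 : K) ∉ A ∧
    ∀ a : Fin n →₀ ℕ, a.degree = d → BorelGE a b → a ≠ b → monomial a (1 : K) ∈ A}

/-- `A + V` is a presentation of an almost Borel-fixed space in degree `d`: `A` is a Borel-fixed
space of monomials of degree `d` and `V` is a subspace of the span of its lower neighbors. -/
structure IsAlmostBorelPair {n : ℕ} {K : Type*} [Field K] (d : ℕ)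
    (A V : Submodule K (MvPolynomial (Fin n) K)) : Prop where
  isMonomialSpace : IsMonomialSpace d A
  isBorelFixed : IsBorelFixed A
  le_span : V ≤ Submodule.span K ((fun b => monomial b (1 : K)) '' lowerNeighbors d A)

/-- A homogeneous ideal: it contains the homogeneous components of each of its elements. -/
def IsHomogeneousIdeal {n : ℕ} {K : Type*} [Field K] (I : Ideal (MvPolynomial (Fin n) K)) : Prop :=
  ∀ f ∈ I, ∀ d : ℕ, homogeneousComponent d f ∈ I

/-- The degree `d` component of an ideal. -/
def gradedPiece {n : ℕ} {K : Type*} [Field K] (I : Ideal (MvPolynomial (Fin n) K)) (d : ℕ) :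
    Submodule K (MvPolynomial (Fin n) K) :=
  I.restrictScalars K ⊓ homogeneousSubmodule (Fin n) K d

/-! ### Generic values are unique over an infinite field -/

theorem HoldsGenerically.exists_and {n : ℕ} {K : Type*} [Field K] [Infinite K]
    {Q Q' : GL (Fin n) K → Prop} (h : HoldsGenerically Q) (h' : HoldsGenerically Q') :
    ∃ g, Q g ∧ Q' g := by
  obtain ⟨P, hP, hQ⟩ := h
  obtain ⟨P', hP', hQ'⟩ := h'
  set D : MvPolynomial (Fin n × Fin n) K := (Matrix.mvPolynomialX (Fin n) (Fin n) K).det with hD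
  have hD0 : D ≠ 0 := Matrix.det_mvPolynomialX_ne_zero (Fin n) K
  have hne : P * P' * D ≠ 0 := mul_ne_zero (mul_ne_zero hP hP') hD0
  obtain ⟨x, hx⟩ : ∃ x, eval x (P * P' * D) ≠ 0 := by
    by_contra! hc
    exact hne (MvPolynomial.funext fun x => by simpa using hc x)
  simp only [map_mul, mul_ne_zero_iff] at hx
  obtain ⟨⟨h1, h2⟩, h3⟩ := hx
  have h4 : (Matrix.of fun i j => x (i, j)).det ≠ 0 := by
    rw [hD, RingHom.map_det] at h3
    convert h3 using 2
    ext i j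
    simp
  exact ⟨Matrix.GeneralLinearGroup.mkOfDetNeZero _ h4, hQ _ h1, hQ' _ h2⟩

theorem IsGinSpace.unique {n : ℕ} {K : Type*} [Field K] [Infinite K] {τ : MonomialOrder (Fin n)}
    {U G G' : Submodule K (MvPolynomial (Fin n) K)}
    (h : IsGinSpace τ U G) (h' : IsGinSpace τ U G') : G = G' := by
  obtain ⟨g, h1, h2⟩ := HoldsGenerically.exists_and h h'
  exact h1.symm.trans h2

theorem IsGinIdeal.unique {n : ℕ} {K : Type*} [Field K] [Infinite K] {τ : MonomialOrder (Fin n)}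
    {I J J' : Ideal (MvPolynomial (Fin n) K)}
    (h : IsGinIdeal τ I J) (h' : IsGinIdeal τ I J') : J = J' := by
  obtain ⟨g, h1, h2⟩ := HoldsGenerically.exists_and h h'
  exact h1.symm.trans h2

end

end GenericInitial

open GenericInitial

/-!
The argument rests on the factorization `g = L U⁻¹` of a generic matrix into a lower triangular
matrix `L` and a unipotent upper triangular one (`exists_upper_mul_eq_lower`); the only genericity
needed is that the leading principal minors of `g` do not vanish, a condition that does not depend
on the degree, so that the same open set serves all graded pieces of an ideal.

The lower triangular factor is harmless: since `x_1 > … > x_n`, it sends a monomial to a nonzero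
multiple of itself plus smaller monomials, and so `in_τ(L W) = in_τ(W)` for every subspace `W`
(`initialSpace_map_of_lower`). The unipotent upper triangular factor fixes an almost Borel-fixed
space `A + V`: it fixes `A`, and it sends a monomial `b` to `b` plus monomials strictly above `b` in
the Borel order, which lie in `A` if `b` is a lower neighbor (`IsAlmostBorelPair.map_eq`). Hence
`in_τ(g(A + V)) = in_τ(L(A + V)) = in_τ(A + V)`, and this is `A + in_τ(V)` because `A` is spanned by
monomials and no monomial of `A` occurs in an element of `V` (`IsAlmostBorelPair.initialSpace_sup`).

A homogeneous ideal whose graded pieces are fixed by the unipotent upper triangular matrices is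
itself fixed by them, so its generic initial ideal is its initial ideal, and taking initial spaces
commutes with taking graded pieces (`gradedPiece_initialIdeal`).
-/

namespace GenericInitial

/-! ### Coordinate changes -/

section ChangeCoords

variable {n : ℕ} {K : Type*} [Field K]

theorem changeCoords_X (g : GL (Fin n) K) (i : Fin n) :
    changeCoords g (X i) = ∑ j, C (g j i) * X j := by
  simp [changeCoords]

theorem changeCoords_mul (g h : GL (Fin n) K) :
    changeCoords (g * h) = (changeCoords g).comp (changeCoords h) := by
  refine MvPolynomial.algHom_ext fun i => ?_
  simp only [AlgHom.comp_apply, changeCoords_X, map_sum, map_mul, Finset.mul_sum,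
    Units.val_mul, Matrix.mul_apply, Finset.sum_mul, algHom_C, algebraMap_eq]
  rw [Finset.sum_comm]
  refine Finset.sum_congr rfl fun j _ => Finset.sum_congr rfl fun k _ => ?_
  ring

theorem changeCoords_one : changeCoords (1 : GL (Fin n) K) = AlgHom.id K _ := by
  refine MvPolynomial.algHom_ext fun i => ?_
  rw [changeCoords_X, Finset.sum_eq_single i] <;> simp +contextual

theorem changeCoords_surjective (g : GL (Fin n) K) :
    Function.Surjective (changeCoords g) := fun f => ⟨changeCoords g⁻¹ f, by
  rw [← AlgHom.comp_apply, ← changeCoords_mul, mul_inv_cancel, changeCoords_one]; rfl⟩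

theorem isHomogeneous_changeCoords (g : GL (Fin n) K) {f : MvPolynomial (Fin n) K} {d : ℕ}
    (hf : f.IsHomogeneous d) : (changeCoords g f).IsHomogeneous d := by
  have := IsHomogeneous.aeval hf (n := 1) (fun i => ∑ j, C (g j i) * X j)
    fun i => IsHomogeneous.sum _ _ _ fun j _ => isHomogeneous_C_mul_X _ _
  simpa [changeCoords] using this

theorem map_changeCoords_mul (g h : GL (Fin n) K) (W : Submodule K (MvPolynomial (Fin n) K)) :
    W.map (changeCoords (g * h)).toLinearMap =
      (W.map (changeCoords h).toLinearMap).map (changeCoords g).toLinearMap := by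
  rw [← Submodule.map_comp, changeCoords_mul]
  rfl

theorem coeff_single_changeCoords_X (g : GL (Fin n) K) (i j : Fin n) :
    coeff (Finsupp.single j 1) (changeCoords g (X i)) = g j i := by
  simp only [changeCoords_X, coeff_sum, coeff_C_mul, coeff_X, Finsupp.single_left_inj one_ne_zero]
  simp

theorem eq_single_of_mem_support_changeCoords_X (g : GL (Fin n) K) {i : Fin n} {b : Fin n →₀ ℕ}
    (hb : b ∈ (changeCoords g (X i)).support) : ∃ j, b = Finsupp.single j 1 ∧ g j i ≠ 0 := by
  rw [mem_support_iff] at hb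
  have hb' := hb
  rw [changeCoords_X, coeff_sum] at hb'
  obtain ⟨j, -, hj⟩ := Finset.exists_ne_zero_of_sum_ne_zero hb'
  rw [coeff_C_mul, coeff_X] at hj
  obtain rfl : Finsupp.single j 1 = b := by
    by_contra h
    simp [h] at hj
  exact ⟨j, rfl, by rwa [coeff_single_changeCoords_X] at hb⟩

end ChangeCoords

/-! ### Lower triangular matrices preserve initial spaces -/

section Lower

variable {n : ℕ} {K : Type*} [Field K] {τ : MonomialOrder (Fin n)}

theorem _root_.MonomialOrder.degree_eq_of_forall_le {f : MvPolynomial (Fin n) K} {m : Fin n →₀ ℕ}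
    (hm : coeff m f ≠ 0) (h : ∀ b ∈ f.support, b ≼[τ] m) : τ.degree f = m :=
  τ.toSyn.injective <| le_antisymm (τ.degree_le_iff.2 h) (τ.le_degree (mem_support_iff.2 hm))

theorem diag_ne_zero_of_lower (L : GL (Fin n) K) (hL : ∀ i j, i < j → L i j = 0) (i : Fin n) :
    L i i ≠ 0 := by
  have h : (L : Matrix (Fin n) (Fin n) K).det ≠ 0 := L.det_ne_zero
  rw [Matrix.det_of_isLowerTriangular _ (fun i j hij => hL i j hij)] at h
  exact Finset.prod_ne_zero_iff.1 h i (Finset.mem_univ i)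

theorem degree_changeCoords_X_of_lower (hτ : IsStandardOrder τ) (L : GL (Fin n) K)
    (hL : ∀ i j, i < j → L i j = 0) (i : Fin n) :
    τ.degree (changeCoords L (X i)) = Finsupp.single i 1 := by
  refine MonomialOrder.degree_eq_of_forall_le ?_ fun b hb => ?_
  · rw [coeff_single_changeCoords_X]
    exact diag_ne_zero_of_lower L hL i
  · obtain ⟨j, rfl, hj⟩ := eq_single_of_mem_support_changeCoords_X L hb
    rcases lt_trichotomy i j with h | rfl | h
    · exact (hτ i j h).le
    · exact le_rfl
    · exact absurd (hL j i h) hj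

theorem changeCoords_monomial (g : GL (Fin n) K) (a : Fin n →₀ ℕ) :
    changeCoords g (monomial a 1) = ∏ i, changeCoords g (X i) ^ a i := by
  rw [monomial_eq, C_1, one_mul, Finsupp.prod_fintype _ _ (by simp)]
  simp

theorem changeCoords_X_ne_zero_of_lower (L : GL (Fin n) K)
    (hL : ∀ i j, i < j → L i j = 0) (i : Fin n) : changeCoords L (X i) ≠ 0 := fun h =>
  diag_ne_zero_of_lower L hL i (by rw [← coeff_single_changeCoords_X L i i, h, coeff_zero])

theorem degree_changeCoords_monomial_of_lower (hτ : IsStandardOrder τ) (L : GL (Fin n) K)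
    (hL : ∀ i j, i < j → L i j = 0) (a : Fin n →₀ ℕ) :
    τ.degree (changeCoords L (monomial a 1)) = a := by
  rw [changeCoords_monomial, τ.degree_prod fun i _ =>
    pow_ne_zero _ (changeCoords_X_ne_zero_of_lower L hL i)]
  simp only [τ.degree_pow, degree_changeCoords_X_of_lower hτ L hL]
  ext i
  simp

/-- A lower triangular coordinate change sends each monomial to a nonzero multiple of itself plus
`τ`-smaller monomials, so it does not change leading exponents. -/
theorem degree_changeCoords_of_lower (hτ : IsStandardOrder τ) (L : GL (Fin n) K)
    (hL : ∀ i j, i < j → L i j = 0) (f : MvPolynomial (Fin n) K) :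
    τ.degree (changeCoords L f) = τ.degree f := by
  rcases eq_or_ne f 0 with rfl | hf
  · simp
  have hsum : changeCoords L f =
      ∑ m ∈ f.support, coeff m f • changeCoords L (monomial m 1) := by
    conv_lhs => rw [f.as_sum]
    rw [map_sum]
    refine Finset.sum_congr rfl fun m _ => ?_
    rw [← map_smul, smul_monomial, smul_eq_mul, mul_one]
  have hdeg := degree_changeCoords_monomial_of_lower hτ L hL
  refine MonomialOrder.degree_eq_of_forall_le ?_ fun b hb => ?_
  · rw [hsum, coeff_sum, Finset.sum_eq_single (τ.degree f)]
    · rw [coeff_smul, smul_eq_mul]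
      refine mul_ne_zero (τ.coeff_degree_ne_zero_iff.2 hf) ?_
      nth_rewrite 1 [← hdeg (τ.degree f)]
      rw [τ.coeff_degree_ne_zero_iff, changeCoords_monomial]
      exact Finset.prod_ne_zero_iff.2 fun i _ =>
        pow_ne_zero _ (changeCoords_X_ne_zero_of_lower L hL i)
    · intro m hm hne
      rw [coeff_smul, τ.coeff_eq_zero_of_lt (f := changeCoords L (monomial m 1)), smul_zero]
      rw [hdeg]
      exact lt_of_le_of_ne (τ.le_degree hm) fun h => hne (τ.toSyn.injective h)
    · exact fun h => absurd (τ.degree_mem_support hf) h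
  · rw [mem_support_iff, hsum, coeff_sum] at hb
    obtain ⟨m, hm, hbm⟩ := Finset.exists_ne_zero_of_sum_ne_zero hb
    rw [coeff_smul] at hbm
    have h := τ.le_degree (mem_support_iff.2 (right_ne_zero_of_smul hbm))
    rw [hdeg] at h
    exact h.trans (τ.le_degree hm)

theorem monomial_degree_mem_initialSpace {W : Submodule K (MvPolynomial (Fin n) K)}
    {f : MvPolynomial (Fin n) K} (hf : f ∈ W) (hf0 : f ≠ 0) (c : K) :
    monomial (τ.degree f) c ∈ initialSpace τ W := by
  have h : τ.leadingTerm f ∈ initialSpace τ W := Submodule.subset_span ⟨f, hf, rfl⟩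
  have h' := Submodule.smul_mem _ (c * (τ.leadingCoeff f)⁻¹) h
  rwa [MonomialOrder.leadingTerm, smul_monomial, smul_eq_mul, mul_assoc,
    inv_mul_cancel₀ (τ.leadingCoeff_ne_zero_iff.2 hf0), mul_one] at h'

/-- Containment of initial spaces is tested on leading exponents. -/
theorem initialSpace_le {W : Submodule K (MvPolynomial (Fin n) K)}
    {W' : Submodule K (MvPolynomial (Fin n) K)}
    (h : ∀ f ∈ W, f ≠ 0 → ∀ c : K, monomial (τ.degree f) c ∈ W') : initialSpace τ W ≤ W' := by
  refine Submodule.span_le.2 ?_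
  rintro _ ⟨f, hf, rfl⟩
  rcases eq_or_ne f 0 with rfl | hf0
  · simp
  · exact h f hf hf0 _

theorem initialSpace_mono {W W' : Submodule K (MvPolynomial (Fin n) K)} (h : W ≤ W') :
    initialSpace τ W ≤ initialSpace τ W' :=
  Submodule.span_mono (Set.image_mono h)

/-- The initial space of an arbitrary subspace is unchanged by lower triangular matrices. -/
theorem initialSpace_map_of_lower (hτ : IsStandardOrder τ) (L : GL (Fin n) K)
    (hL : ∀ i j, i < j → L i j = 0) (W : Submodule K (MvPolynomial (Fin n) K)) :
    initialSpace τ (W.map (changeCoords L).toLinearMap) = initialSpace τ W := by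
  refine le_antisymm (initialSpace_le ?_) (initialSpace_le fun f hf hf0 c => ?_)
  · rintro _ ⟨f, hf, rfl⟩ hne c
    have hf0 : f ≠ 0 := fun h => hne (by simp [h])
    have := monomial_degree_mem_initialSpace (τ := τ) hf hf0 c
    rwa [← degree_changeCoords_of_lower hτ L hL f] at this
  · rw [← degree_changeCoords_of_lower hτ L hL f]
    refine monomial_degree_mem_initialSpace (Submodule.mem_map_of_mem hf) (fun h => hf0 ?_) c
    have h1 : changeCoords L⁻¹ (changeCoords L f) = f := by
      rw [← AlgHom.comp_apply, ← changeCoords_mul, inv_mul_cancel, changeCoords_one]; rfl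
    rw [← h1, show changeCoords L f = 0 from h, map_zero]

end Lower

/-! ### Unipotent upper triangular matrices and the Borel order -/

section Upper

variable {n : ℕ} {K : Type*} [Field K]

theorem BorelGE.refl (a : Fin n →₀ ℕ) : BorelGE a a := fun _ => le_rfl

theorem BorelGE.add {a b a' b' : Fin n →₀ ℕ} (h : BorelGE a b) (h' : BorelGE a' b') :
    BorelGE (a + a') (b + b') := fun k => by
  simp only [Finsupp.add_apply, Finset.sum_add_distrib]
  exact add_le_add (h k) (h' k)

theorem BorelGE.antisymm {a b : Fin n →₀ ℕ} (h : BorelGE a b) (h' : BorelGE b a) : a = b := by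
  ext k
  induction k using WellFoundedLT.induction with
  | ind k ih =>
    have hk := le_antisymm (h' k) (h k)
    rw [← Finset.Iio_insert, Finset.sum_insert (by simp), Finset.sum_insert (by simp),
      Finset.sum_congr rfl fun i hi => ih i (Finset.mem_Iio.1 hi)] at hk
    exact Nat.add_right_cancel hk

theorem BorelGE.eq_of_add_eq {a b a' b' : Fin n →₀ ℕ} (h : BorelGE a b) (h' : BorelGE a' b')
    (hs : a + a' = b + b') : a = b := by
  refine BorelGE.antisymm h fun k => ?_
  have h1 := DFunLike.congr_fun hs
  have h2 : ∑ i ∈ Finset.Iic k, (a + a') i = ∑ i ∈ Finset.Iic k, (b + b') i :=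
    Finset.sum_congr rfl fun i _ => h1 i
  simp only [Finsupp.add_apply, Finset.sum_add_distrib] at h2
  have := h' k
  omega

theorem borelGE_single {i j : Fin n} (h : j ≤ i) :
    BorelGE (Finsupp.single j 1) (Finsupp.single i 1) := fun k => by
  simp only [Finsupp.single_apply, Finset.sum_ite_eq, Finset.mem_Iic]
  split_ifs with h1 h2
  · exact le_rfl
  · exact absurd (h.trans h1) h2
  · exact Nat.zero_le _
  · exact le_rfl

/-- `p` is the monomial `b` plus a combination of monomials that are strictly larger in the Borel
order. Strictness is encoded by the coefficient `1` at `b`; the order is not restricted to a fixed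
degree, so homogeneity of `p` is tracked separately. -/
def IsBorelMonicAt (p : MvPolynomial (Fin n) K) (b : Fin n →₀ ℕ) : Prop :=
  coeff b p = 1 ∧ ∀ a ∈ p.support, BorelGE a b

theorem IsBorelMonicAt.one : IsBorelMonicAt (1 : MvPolynomial (Fin n) K) 0 := by
  refine ⟨by simp, fun a ha => ?_⟩
  obtain rfl : a = 0 := by simpa using ha
  exact BorelGE.refl _

theorem IsBorelMonicAt.mul {p q : MvPolynomial (Fin n) K} {b c : Fin n →₀ ℕ}
    (hp : IsBorelMonicAt p b) (hq : IsBorelMonicAt q c) : IsBorelMonicAt (p * q) (b + c) := by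
  constructor
  · rw [coeff_mul, Finset.sum_eq_single (b, c)]
    · rw [hp.1, hq.1, mul_one]
    · rintro ⟨x, y⟩ hxy hne
      rw [Finset.HasAntidiagonal.mem_antidiagonal] at hxy
      dsimp only at hxy ⊢
      by_contra h
      have hx := hp.2 x (mem_support_iff.2 (left_ne_zero_of_mul h))
      have hy := hq.2 y (mem_support_iff.2 (right_ne_zero_of_mul h))
      obtain rfl := hx.eq_of_add_eq hy hxy
      exact hne (by rw [add_left_cancel hxy])
    · simp
  · intro a ha
    classical
    obtain ⟨x, hx, y, hy, rfl⟩ := Finset.mem_add.1 (support_mul p q ha)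
    exact (hp.2 x hx).add (hq.2 y hy)

theorem IsBorelMonicAt.pow {p : MvPolynomial (Fin n) K} {b : Fin n →₀ ℕ}
    (hp : IsBorelMonicAt p b) (k : ℕ) : IsBorelMonicAt (p ^ k) (k • b) := by
  induction k with
  | zero => simpa using IsBorelMonicAt.one
  | succ k ih => rw [pow_succ, succ_nsmul]; exact ih.mul hp

theorem IsBorelMonicAt.prod {ι : Type*} (s : Finset ι) {p : ι → MvPolynomial (Fin n) K}
    {b : ι → Fin n →₀ ℕ} (hp : ∀ i, IsBorelMonicAt (p i) (b i)) :
    IsBorelMonicAt (∏ i ∈ s, p i) (∑ i ∈ s, b i) := by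
  classical
  induction s using Finset.induction_on with
  | empty => simpa using IsBorelMonicAt.one
  | insert i s hi ih => rw [Finset.prod_insert hi, Finset.sum_insert hi]; exact (hp i).mul ih

theorem isBorelMonicAt_changeCoords_monomial (U : GL (Fin n) K) (hU : ∀ i j, j < i → U i j = 0)
    (hU1 : ∀ i, U i i = 1) (b : Fin n →₀ ℕ) :
    IsBorelMonicAt (changeCoords U (monomial b 1)) b := by
  have hX (i : Fin n) : IsBorelMonicAt (changeCoords U (X i)) (Finsupp.single i 1) := by
    refine ⟨by rw [coeff_single_changeCoords_X, hU1], fun a ha => ?_⟩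
    obtain ⟨j, rfl, hj⟩ := eq_single_of_mem_support_changeCoords_X U ha
    exact borelGE_single (not_lt.1 fun h => hj (hU j i h))
  have := IsBorelMonicAt.prod Finset.univ fun i => (hX i).pow (b i)
  rw [← changeCoords_monomial] at this
  convert this using 1
  ext i
  simp

theorem mem_of_forall_support {A : Submodule K (MvPolynomial (Fin n) K)}
    {f : MvPolynomial (Fin n) K} (h : ∀ a ∈ f.support, monomial a (1 : K) ∈ A) : f ∈ A := by
  rw [f.as_sum]
  refine Submodule.sum_mem _ fun a ha => ?_
  have := A.smul_mem (coeff a f) (h a ha)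
  rwa [smul_monomial, smul_eq_mul, mul_one] at this

/-- A unipotent upper triangular coordinate change fixes lower neighbors of `A` modulo `A`. -/
theorem changeCoords_sub_mem {d : ℕ} {A V : Submodule K (MvPolynomial (Fin n) K)}
    (h : IsAlmostBorelPair d A V) (U : GL (Fin n) K) (hU : ∀ i j, j < i → U i j = 0)
    (hU1 : ∀ i, U i i = 1) {v : MvPolynomial (Fin n) K} (hv : v ∈ V) :
    changeCoords U v - v ∈ A := by
  suffices V ≤ A.comap ((changeCoords U).toLinearMap - LinearMap.id) from this hv
  refine h.le_span.trans (Submodule.span_le.2 ?_)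
  rintro _ ⟨b, ⟨hbd, -, hb⟩, rfl⟩
  change changeCoords U (monomial b 1) - monomial b 1 ∈ A
  obtain ⟨h1, h2⟩ := isBorelMonicAt_changeCoords_monomial U hU hU1 b
  have hhom := isHomogeneous_changeCoords U (isHomogeneous_monomial (1 : K) hbd)
  refine mem_of_forall_support fun a ha => ?_
  rw [mem_support_iff, coeff_sub, coeff_monomial] at ha
  have hab : a ≠ b := by
    rintro rfl
    simp [h1] at ha
  rw [if_neg hab.symm, sub_zero] at ha
  refine hb a ?_ (h2 a (mem_support_iff.2 ha)) hab
  by_contra hda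
  exact ha (hhom.coeff_eq_zero hda)

theorem IsBorelFixed.map_eq {A : Submodule K (MvPolynomial (Fin n) K)} (hA : IsBorelFixed A)
    (U : GL (Fin n) K) (hU : ∀ i j, j < i → U i j = 0) :
    A.map (changeCoords U).toLinearMap = A := by
  have hU' : (U : Matrix (Fin n) (Fin n) K).BlockTriangular id := fun i j hij => hU i j hij
  refine le_antisymm (hA U hU') ?_
  have hinv : ((U⁻¹ : GL (Fin n) K) : Matrix (Fin n) (Fin n) K).BlockTriangular id := by
    rw [Matrix.coe_units_inv]
    have := U.invertible
    exact Matrix.blockTriangular_inv_of_blockTriangular hU'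
  have := Submodule.map_mono (f := (changeCoords U).toLinearMap) (hA U⁻¹ hinv)
  rw [← map_changeCoords_mul, mul_inv_cancel, changeCoords_one] at this
  exact (Submodule.map_id A).ge.trans this

theorem IsAlmostBorelPair.map_eq {d : ℕ} {A V : Submodule K (MvPolynomial (Fin n) K)}
    (h : IsAlmostBorelPair d A V) (U : GL (Fin n) K) (hU : ∀ i j, j < i → U i j = 0)
    (hU1 : ∀ i, U i i = 1) :
    (A ⊔ V).map (changeCoords U).toLinearMap = A ⊔ V := by
  have hA := h.isBorelFixed.map_eq U hU
  rw [Submodule.map_sup, hA]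
  refine le_antisymm (sup_le le_sup_left ?_) (sup_le le_sup_left fun v hv => ?_)
  · rintro _ ⟨v, hv, rfl⟩
    have := Submodule.add_mem_sup (changeCoords_sub_mem h U hU hU1 hv) hv
    rwa [sub_add_cancel] at this
  · have := Submodule.add_mem_sup (A.neg_mem (changeCoords_sub_mem h U hU hU1 hv))
      (Submodule.mem_map_of_mem (f := (changeCoords U).toLinearMap) hv)
    simpa using this

end Upper

/-! ### Generic matrices are lower triangular up to a unipotent upper triangular factor -/

section LU

variable {n : ℕ} {K : Type*} [Field K]

/-- The product of the leading principal minors of the generic `n × n` matrix, the `k`-th minor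
being indexed by the `j < k`. -/
noncomputable def leadingMinors (n : ℕ) (K : Type*) [Field K] :
    MvPolynomial (Fin n × Fin n) K :=
  ∏ k : Fin n, ((Matrix.mvPolynomialX (Fin n) (Fin n) K).submatrix
    (Subtype.val : {j // j < k} → Fin n) Subtype.val).det

theorem eval_leadingMinors (M : Matrix (Fin n) (Fin n) K) :
    eval (fun ij => M ij.1 ij.2) (leadingMinors n K) =
      ∏ k : Fin n, (M.submatrix (Subtype.val : {j // j < k} → Fin n) Subtype.val).det := by
  rw [leadingMinors, map_prod]
  refine Finset.prod_congr rfl fun k _ => ?_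
  rw [RingHom.map_det]
  congr 1
  ext i j
  simp

theorem leadingMinors_ne_zero : leadingMinors n K ≠ 0 := by
  intro h
  have h1 := eval_leadingMinors (1 : Matrix (Fin n) (Fin n) K)
  simp [h, Matrix.submatrix_one _ Subtype.val_injective] at h1

/-- If the leading principal minors of `g` do not vanish, then `g = L U⁻¹` with `L` lower triangular
and `U` unipotent upper triangular. -/
theorem exists_upper_mul_eq_lower (g : GL (Fin n) K)
    (hg : eval (fun ij => g ij.1 ij.2) (leadingMinors n K) ≠ 0) :
    ∃ U : GL (Fin n) K, (∀ i j, j < i → U i j = 0) ∧ (∀ i, U i i = 1) ∧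
      ∀ i j, i < j → (g * U : GL (Fin n) K) i j = 0 := by
  rw [eval_leadingMinors, Finset.prod_ne_zero_iff] at hg
  -- Column `k` of `U` clears the entries of column `k` of `g` above the diagonal by adding
  -- multiples of the earlier columns; the linear system has the `k`-th leading minor as determinant.
  have hsol (k : Fin n) : ∃ u : {j // j < k} → K,
      (g.val.submatrix (Subtype.val : {j // j < k} → Fin n)
        (Subtype.val : {j // j < k} → Fin n)).mulVec u =
        fun i => - g.val i.1 k := by
    have hdet := (hg k (Finset.mem_univ k)).isUnit
    refine ⟨(g.val.submatrix (Subtype.val : {j // j < k} → Fin n)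
      (Subtype.val : {j // j < k} → Fin n))⁻¹.mulVec
      fun i => - g.val i.1 k, ?_⟩
    rw [Matrix.mulVec_mulVec, Matrix.mul_nonsing_inv _ hdet, Matrix.one_mulVec]
  choose u hu using hsol
  let M : Matrix (Fin n) (Fin n) K := Matrix.of fun j k =>
    if h : j < k then u k ⟨j, h⟩ else if j = k then 1 else 0
  have hM0 (i j : Fin n) (h : j < i) : M i j = 0 := by simp [M, h.not_gt, h.ne']
  have hM1 (i : Fin n) : M i i = 1 := by simp [M]
  have hdet : M.det ≠ 0 := by
    rw [Matrix.det_of_isUpperTriangular (fun i j hij => hM0 i j hij)]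
    simp [hM1]
  refine ⟨Matrix.GeneralLinearGroup.mkOfDetNeZero M hdet, hM0, hM1, fun i k hik => ?_⟩
  change (g.val * M) i k = 0
  have hik' := congrFun (hu k) ⟨i, hik⟩
  rw [Matrix.mulVec, dotProduct] at hik'
  have hlt : ∑ j ∈ Finset.univ.filter (· < k), g.val i j * M j k = - g.val i k := by
    rw [← hik', Finset.sum_subtype (p := fun j => j < k) _ (by simp)]
    refine Finset.sum_congr rfl fun j _ => ?_
    simp [M, j.2]
  have hge : ∑ j ∈ Finset.univ.filter (fun j => ¬ j < k), g.val i j * M j k = g.val i k := by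
    rw [Finset.sum_eq_single k]
    · rw [hM1, mul_one]
    · intro j hj hjk
      have hkj : k < j := lt_of_le_of_ne (not_lt.1 (Finset.mem_filter.1 hj).2) hjk.symm
      rw [hM0 j k hkj, mul_zero]
    · simp
  rw [Matrix.mul_apply, ← Finset.sum_filter_add_sum_filter_not _ (· < k), hlt, hge,
    neg_add_cancel]

/-- A space that is stable under the unipotent upper triangular matrices has the same initial
space after a generic coordinate change as before it. -/
theorem isGinSpace_initialSpace {τ : MonomialOrder (Fin n)} (hτ : IsStandardOrder τ)
    {W : Submodule K (MvPolynomial (Fin n) K)}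
    (hW : ∀ U : GL (Fin n) K, (∀ i j, j < i → U i j = 0) → (∀ i, U i i = 1) →
      W.map (changeCoords U).toLinearMap = W) :
    IsGinSpace τ W (initialSpace τ W) := by
  refine ⟨leadingMinors n K, leadingMinors_ne_zero, fun g hg => ?_⟩
  obtain ⟨U, hU, hU1, hL⟩ := exists_upper_mul_eq_lower g hg
  have h := initialSpace_map_of_lower hτ (g * U) hL W
  rwa [map_changeCoords_mul, hW U hU hU1] at h

end LU

/-! ### The initial space of an almost Borel-fixed space -/

section AlmostBorel

variable {n : ℕ} {K : Type*} [Field K] {τ : MonomialOrder (Fin n)}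

theorem monomial_mem_of_mem_support {d : ℕ} {A : Submodule K (MvPolynomial (Fin n) K)}
    (hA : IsMonomialSpace d A) {f : MvPolynomial (Fin n) K} (hf : f ∈ A) {m : Fin n →₀ ℕ}
    (hm : m ∈ f.support) (c : K) : monomial m c ∈ A := by
  obtain ⟨S, -, rfl⟩ := hA
  rw [← restrictSupport_eq_span] at hf ⊢
  rw [mem_restrictSupport_iff] at hf ⊢
  exact (Finset.coe_subset.2 support_monomial_subset).trans (by simpa using hf hm)

theorem monomial_notMem_of_mem_support {d : ℕ} {A V : Submodule K (MvPolynomial (Fin n) K)}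
    (h : IsAlmostBorelPair d A V) {v : MvPolynomial (Fin n) K} (hv : v ∈ V) {m : Fin n →₀ ℕ}
    (hm : m ∈ v.support) : monomial m (1 : K) ∉ A := by
  have hv' := h.le_span hv
  rw [← restrictSupport_eq_span, mem_restrictSupport_iff] at hv'
  exact (hv' hm).2.1

/-- The elements of `A` and of `V` have disjoint supports, so a leading term of `a + v` that is
not in `A` is the leading term of `v`. -/
theorem IsAlmostBorelPair.initialSpace_sup {d : ℕ} {A V : Submodule K (MvPolynomial (Fin n) K)}
    (h : IsAlmostBorelPair d A V) : initialSpace τ (A ⊔ V) = A ⊔ initialSpace τ V := by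
  refine le_antisymm (initialSpace_le fun f hf hf0 c => ?_)
    (sup_le (fun f hf => ?_) (initialSpace_mono le_sup_right))
  · obtain ⟨a, ha, v, hv, rfl⟩ := Submodule.mem_sup.1 hf
    by_cases hm : τ.degree (a + v) ∈ a.support
    · exact Submodule.mem_sup_left (monomial_mem_of_mem_support h.isMonomialSpace ha hm c)
    · have hcoeff : coeff (τ.degree (a + v)) v ≠ 0 := by
        have h1 := τ.coeff_degree_ne_zero_iff.2 hf0
        rwa [coeff_add, notMem_support_iff.1 hm, zero_add] at h1
      have hdeg : τ.degree v = τ.degree (a + v) := by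
        refine MonomialOrder.degree_eq_of_forall_le hcoeff fun b hb => τ.le_degree ?_
        have hba : b ∉ a.support := fun hba => monomial_notMem_of_mem_support h hv hb
          (monomial_mem_of_mem_support h.isMonomialSpace ha hba 1)
        rw [mem_support_iff, coeff_add, notMem_support_iff.1 hba, zero_add]
        exact mem_support_iff.1 hb
      rw [← hdeg]
      refine Submodule.mem_sup_right (monomial_degree_mem_initialSpace hv ?_ c)
      rintro rfl
      simp at hcoeff
  · refine mem_of_forall_support fun m hm => ?_
    have hmA := monomial_mem_of_mem_support h.isMonomialSpace hf hm 1
    classical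
    have := monomial_degree_mem_initialSpace (τ := τ) (Submodule.mem_sup_left (T := V) hmA)
      (by simp) 1
    rwa [τ.degree_monomial, if_neg one_ne_zero] at this

end AlmostBorel

/-! ### Initial ideals -/

section Ideals

variable {n : ℕ} {K : Type*} [Field K] {τ : MonomialOrder (Fin n)}

/-- Leading terms are multiplicative, so the `K`-span of the leading terms of an ideal is already
closed under multiplication by monomials. -/
theorem restrictScalars_initialIdeal (I : Ideal (MvPolynomial (Fin n) K)) :
    (initialIdeal τ I).restrictScalars K = initialSpace τ (I.restrictScalars K) := by
  refine le_antisymm (fun f hf => ?_) (Submodule.span_le.2 ?_)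
  · change f ∈ Submodule.span _ _ at hf
    induction hf using Submodule.span_induction with
    | mem x hx => exact Submodule.subset_span hx
    | zero => exact zero_mem _
    | add x y _ _ hx hy => exact add_mem hx hy
    | smul p x _ hx =>
      suffices hm : ∀ m : Fin n →₀ ℕ, initialSpace τ (I.restrictScalars K) ≤
          (initialSpace τ (I.restrictScalars K)).comap (LinearMap.mulLeft K (monomial m 1)) by
        rw [p.as_sum, Finset.sum_smul]
        refine Submodule.sum_mem _ fun m _ => ?_
        have := Submodule.smul_mem _ (coeff m p) (hm m hx)
        rwa [Submodule.mem_comap, map_smul, LinearMap.mulLeft_apply, ← smul_mul_assoc,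
          smul_monomial, smul_eq_mul, mul_one] at this
      intro m
      refine initialSpace_le fun f hf hf0 c => ?_
      have hm0 : (monomial m (1 : K)) ≠ 0 := by simp
      have h := monomial_degree_mem_initialSpace (τ := τ) (W := I.restrictScalars K)
        (I.mul_mem_left (monomial m 1) hf) (mul_ne_zero hm0 hf0) c
      classical
      rw [τ.degree_mul hm0 hf0, τ.degree_monomial, if_neg one_ne_zero] at h
      simpa [monomial_mul] using h
  · exact fun x hx => Ideal.subset_span hx

theorem restrictScalars_map_changeCoords (I : Ideal (MvPolynomial (Fin n) K))
    (g : GL (Fin n) K) : (I.map (changeCoords g)).restrictScalars K =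
      (I.restrictScalars K).map (changeCoords g).toLinearMap := by
  ext f
  exact Ideal.mem_map_iff_of_surjective (changeCoords g) (changeCoords_surjective g)

/-- For a homogeneous ideal, taking components of degree `d` sends leading terms of elements to
leading terms of elements of degree `d`, or to zero. -/
theorem initialSpace_le_comap_homogeneousComponent {I : Ideal (MvPolynomial (Fin n) K)}
    (hI : IsHomogeneousIdeal I) (d : ℕ) : initialSpace τ (I.restrictScalars K) ≤
      (initialSpace τ (gradedPiece I d)).comap (homogeneousComponent d) := by
  refine initialSpace_le fun f hf hf0 c => ?_
  rw [Submodule.mem_comap]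
  have hmon : (monomial (τ.degree f) c).IsHomogeneous (τ.degree f).degree :=
    isHomogeneous_monomial c rfl
  rw [homogeneousComponent_of_mem ((mem_homogeneousSubmodule _ _).2 hmon)]
  split_ifs with hd
  · have hc : coeff (τ.degree f) (homogeneousComponent d f) ≠ 0 := by
      rw [coeff_homogeneousComponent, if_pos hd.symm]
      exact τ.coeff_degree_ne_zero_iff.2 hf0
    have hdeg : τ.degree (homogeneousComponent d f) = τ.degree f := by
      refine MonomialOrder.degree_eq_of_forall_le hc fun b hb => τ.le_degree ?_
      rw [mem_support_iff, coeff_homogeneousComponent] at hb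
      exact mem_support_iff.2 fun h => hb (by simp [h])
    rw [← hdeg]
    have hmem : homogeneousComponent d f ∈ gradedPiece I d :=
      ⟨hI f hf d, homogeneousComponent_mem d f⟩
    refine monomial_degree_mem_initialSpace hmem ?_ c
    intro h
    simp [h] at hc
  · exact zero_mem _

theorem initialSpace_le_homogeneousSubmodule {W : Submodule K (MvPolynomial (Fin n) K)} {d : ℕ}
    (hW : W ≤ homogeneousSubmodule (Fin n) K d) :
    initialSpace τ W ≤ homogeneousSubmodule (Fin n) K d :=
  initialSpace_le fun _ hf hf0 c =>
    isHomogeneous_monomial c (by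
      by_contra h
      exact τ.coeff_degree_ne_zero_iff.2 hf0 (IsHomogeneous.coeff_eq_zero (hW hf) h))

theorem gradedPiece_initialIdeal {I : Ideal (MvPolynomial (Fin n) K)}
    (hI : IsHomogeneousIdeal I) (d : ℕ) :
    gradedPiece (initialIdeal τ I) d = initialSpace τ (gradedPiece I d) := by
  rw [gradedPiece, restrictScalars_initialIdeal]
  refine le_antisymm (fun f hf => ?_)
    (le_inf (initialSpace_mono inf_le_left) (initialSpace_le_homogeneousSubmodule inf_le_right))
  have h := initialSpace_le_comap_homogeneousComponent hI d hf.1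
  rwa [Submodule.mem_comap, homogeneousComponent_eq_self hf.2] at h

theorem isHomogeneousIdeal_initialIdeal {I : Ideal (MvPolynomial (Fin n) K)}
    (hI : IsHomogeneousIdeal I) : IsHomogeneousIdeal (initialIdeal τ I) := by
  intro f hf d
  have hf' : f ∈ (initialIdeal τ I).restrictScalars K := hf
  rw [restrictScalars_initialIdeal] at hf'
  have h := initialSpace_le_comap_homogeneousComponent hI d hf'
  rw [Submodule.mem_comap, ← gradedPiece_initialIdeal hI] at h
  exact h.1

theorem map_changeCoords_eq_of_gradedPiece {I : Ideal (MvPolynomial (Fin n) K)}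
    (hI : IsHomogeneousIdeal I) (g : GL (Fin n) K)
    (hg : ∀ d, (gradedPiece I d).map (changeCoords g).toLinearMap = gradedPiece I d) :
    (I.restrictScalars K).map (changeCoords g).toLinearMap = I.restrictScalars K := by
  have hsup : I.restrictScalars K = ⨆ d, gradedPiece I d := by
    refine le_antisymm (fun f hf => ?_) (iSup_le fun d => inf_le_left)
    rw [← sum_homogeneousComponent f]
    exact Submodule.sum_mem _ fun d _ => Submodule.mem_iSup_of_mem d
      ⟨hI f hf d, homogeneousComponent_mem d f⟩
  rw [hsup, Submodule.map_iSup]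
  exact iSup_congr hg

end Ideals

end GenericInitial

theorem proposition5p4 {n : ℕ} {K : Type*} [Field K] [CharZero K] :
    -- generic initial spaces of almost Borel-fixed spaces
    (∀ (d : ℕ) (A V : Submodule K (MvPolynomial (Fin n) K)), IsAlmostBorelPair d A V →
      ∀ τ : MonomialOrder (Fin n), IsStandardOrder τ →
        IsGinSpace τ (A ⊔ V) (A ⊔ initialSpace τ V)) ∧
    -- generic initial ideals of almost Borel-fixed ideals, degree by degree
    (∀ (I : Ideal (MvPolynomial (Fin n) K)) (A V : ℕ → Submodule K (MvPolynomial (Fin n) K)),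
      IsHomogeneousIdeal I →
      (∀ d, IsAlmostBorelPair d (A d) (V d)) →
      (∀ d, gradedPiece I d = A d ⊔ V d) →
      ∀ τ : MonomialOrder (Fin n), IsStandardOrder τ →
        ∃ J : Ideal (MvPolynomial (Fin n) K), IsGinIdeal τ I J ∧
          IsHomogeneousIdeal J ∧
          ∀ d, gradedPiece J d = A d ⊔ initialSpace τ (V d)) := by
  refine ⟨fun d A V h τ hτ => ?_, fun I A V hI h hgr τ hτ => ?_⟩
  · rw [← h.initialSpace_sup]
    exact isGinSpace_initialSpace hτ h.map_eq
  · refine ⟨initialIdeal τ I, ?_, isHomogeneousIdeal_initialIdeal hI, fun d => ?_⟩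
    · obtain ⟨P, hP, hQ⟩ := isGinSpace_initialSpace hτ fun U hU hU1 =>
        map_changeCoords_eq_of_gradedPiece hI U fun d => by rw [hgr, (h d).map_eq U hU hU1]
      refine ⟨P, hP, fun g hg => Submodule.restrictScalars_injective K _ _ ?_⟩
      rw [restrictScalars_initialIdeal, restrictScalars_initialIdeal,
        restrictScalars_map_changeCoords, hQ g hg]
    · rw [gradedPiece_initialIdeal hI, hgr, (h d).initialSpace_sup]
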